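/- Let $\Gamma$ be a discrete group with the approximation property (AP): there is a net $(\varphi_i)$ of finitely supported functions on $\Gamma$ converging to the constant function $1$ in the topology $\sigma(B_2(\Gamma),Q(\Gamma))$. Here $B_2(\Gamma)$ is the space of Herz--Schur multipliers, that is, of functions $\varphi\colon\Gamma\to\mathbb C$ for which there are a Hilbert space $K$ and bounded maps $\xi,\eta\colon\Gamma\to K$ with $\varphi(st^{-1})=\langle\xi_t,\eta_s\rangle$ for all $s,t\in\Gamma$, normed by the infimum of $\sup_t\|\xi_t\|\cdot\sup_s\|\eta_s\|$ over all such $(K,\xi,\eta)$, and $Q(\Gamma)$ is the completion of the space of finitely supported functions $f$ on $\Gamma$ in the norm $\sup\{|\sum_{s}f(s)\varphi(s)| : \varphi\in B_2(\Gamma),\ \|\varphi\|_{B_2}\le 1\}$, which pairs with $B_2(\Gamma)$ by extending $(f,\varphi)\mapsto\sum_s f(s)\varphi(s)$. Let $A$ be a (not necessarily unital) $\Gamma$-$\mathrm{C}^*$-algebra, i.e. a $\mathrm{C}^*$-algebra with an action $\alpha$ of $\Gamma$ by $*$-automorphisms, and let $B\subset A$ be a $\Gamma$-invariant $\mathrm{C}^*$-subalgebra.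 Let $\pi\colon A\to\mathbb B(H)$ be a faithful representation on a Hilbert space $H$. The reduced crossed product $A\rtimes\Gamma$ is realized on $\ell^2(\Gamma,H)$ as the norm closure of the linear span of the operators $\tilde\pi(a)u_g$ ($a\in A$, $g\in\Gamma$), where $(\tilde\pi(a)\zeta)(h)=\pi(\alpha_{h^{-1}}(a))\zeta(h)$ and $(u_g\zeta)(h)=\zeta(g^{-1}h)$. The reduced crossed product $B\rtimes\Gamma$ is realized in the same way through the restriction $\pi|_B$, and is thereby identified with a $\mathrm{C}^*$-subalgebra of $A\rtimes\Gamma$. Let $E\colon A\rtimes\Gamma\to A$ be the canonical conditional expectation, determined by $\pi(E(x))=V^*xV$ with $V\colon H\to\ell^2(\Gamma,H)$, $V\zeta=\delta_e\otimes\zeta$, and put $E_g(x)=E(xu_g^*)$ for $x\in A\rtimes\Gamma$ and $g\in\Gamma$. If an element $x\in A\rtimes\Gamma$ satisfies $E_g(x)\in B$ for all $g\in\Gamma$, then $x\in B\rtimes\Gamma$. -/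

import Mathlib

open Filter Topology
open scoped ENNReal

universe u v w

noncomputable section

/-! ## Herz–Schur multipliers and the approximation property of a discrete group -/

section ApproximationProperty

variable {Γ : Type u} [Group Γ]

/-- `φ` is a Herz–Schur multiplier of norm at most `C`: there are a Hilbert space and bounded
families of vectors `ξ`, `η` with `φ (s t⁻¹) = ⟨η s, ξ t⟩` and `sup ‖ξ‖ * sup ‖η‖ ≤ C`. -/
def IsHerzSchurWith (φ : Γ → ℂ) (C : ℝ) : Prop :=
  ∃ (H : Type u) (_ : NormedAddCommGroup H) (_ : InnerProductSpace ℂ H) (_ : CompleteSpace H)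
    (ξ η : Γ → H) (a b : ℝ), (∀ t, ‖ξ t‖ ≤ a) ∧ (∀ s, ‖η s‖ ≤ b) ∧ a * b ≤ C ∧
      ∀ s t, φ (s * t⁻¹) = inner ℂ (η s) (ξ t)

theorem IsHerzSchurWith.norm_le {φ : Γ → ℂ} {C : ℝ} (h : IsHerzSchurWith φ C) (g : Γ) :
    ‖φ g‖ ≤ C := by
  obtain ⟨H, _, _, _, ξ, η, a, b, ha, hb, hab, hφ⟩ := h
  have h1 := hφ g 1
  simp only [inv_one, mul_one] at h1
  rw [h1]
  calc ‖inner ℂ (η g) (ξ 1)‖ ≤ ‖η g‖ * ‖ξ 1‖ := norm_inner_le_norm _ _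
    _ ≤ b * a := mul_le_mul (hb g) (ha 1) (norm_nonneg _) ((norm_nonneg _).trans (hb g))
    _ ≤ C := by rw [mul_comm]; exact hab

theorem IsHerzSchurWith.nonneg {φ : Γ → ℂ} {C : ℝ} (h : IsHerzSchurWith φ C) : 0 ≤ C :=
  (norm_nonneg _).trans (h.norm_le 1)

theorem IsHerzSchurWith.zero : IsHerzSchurWith (0 : Γ → ℂ) 0 :=
  ⟨lp (fun _ : Γ => ℂ) 2, inferInstance, inferInstance, inferInstance, 0, 0, 0, 0,
    by simp, by simp, by simp, by simp⟩

theorem IsHerzSchurWith.smul {φ : Γ → ℂ} {C : ℝ} (h : IsHerzSchurWith φ C) (c : ℂ) :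
    IsHerzSchurWith (c • φ) (‖c‖ * C) := by
  obtain ⟨H, _, _, _, ξ, η, a, b, ha, hb, hab, hφ⟩ := h
  refine ⟨H, inferInstance, inferInstance, inferInstance, fun t => c • ξ t, η, ‖c‖ * a, b,
    fun t => ?_, hb, ?_, fun s t => ?_⟩
  · rw [norm_smul]; exact mul_le_mul_of_nonneg_left (ha t) (norm_nonneg _)
  · rw [mul_assoc]; exact mul_le_mul_of_nonneg_left hab (norm_nonneg _)
  · simp [hφ]

/-- The two families can be rescaled so that both have squared norms at most `C`. -/
theorem IsHerzSchurWith.balanced {φ : Γ → ℂ} {C : ℝ} (h : IsHerzSchurWith φ C) :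
    ∃ (H : Type u) (_ : NormedAddCommGroup H) (_ : InnerProductSpace ℂ H) (_ : CompleteSpace H)
      (ξ η : Γ → H), (∀ t, ‖ξ t‖ ^ 2 ≤ C) ∧ (∀ s, ‖η s‖ ^ 2 ≤ C) ∧
        ∀ s t, φ (s * t⁻¹) = inner ℂ (η s) (ξ t) := by
  have hC := h.nonneg
  have hle := h.norm_le
  obtain ⟨H, _, _, _, ξ, η, a, b, ha, hb, hab, hφ⟩ := h
  have ha0 : 0 ≤ a := (norm_nonneg _).trans (ha 1)
  have hb0 : 0 ≤ b := (norm_nonneg _).trans (hb 1)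
  rcases (mul_nonneg ha0 hb0).eq_or_lt with h0 | h0
  · refine ⟨H, inferInstance, inferInstance, inferInstance, 0, 0, by simpa using hC,
      by simpa using hC, fun s t => ?_⟩
    have h1 : ‖φ (s * t⁻¹)‖ ≤ 0 := by
      rw [hφ]
      calc ‖inner ℂ (η s) (ξ t)‖ ≤ ‖η s‖ * ‖ξ t‖ := norm_inner_le_norm _ _
        _ ≤ b * a := mul_le_mul (hb s) (ha t) (norm_nonneg _) hb0
        _ = 0 := by rw [mul_comm]; exact h0.symm
    simpa using norm_le_zero_iff.mp h1
  · have ha1 : 0 < a := lt_of_le_of_ne ha0 (by rintro rfl; simp at h0)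
    have hb1 : 0 < b := lt_of_le_of_ne hb0 (by rintro rfl; simp at h0)
    set r : ℝ := Real.sqrt (b / a) with hr
    have hr0 : 0 < r := Real.sqrt_pos.mpr (div_pos hb1 ha1)
    have hr2 : r ^ 2 = b / a := Real.sq_sqrt (div_pos hb1 ha1).le
    refine ⟨H, inferInstance, inferInstance, inferInstance, fun t => (r : ℂ) • ξ t,
      fun s => ((r⁻¹ : ℝ) : ℂ) • η s, fun t => ?_, fun s => ?_, fun s t => ?_⟩
    · rw [norm_smul, mul_pow, Complex.norm_real, Real.norm_of_nonneg hr0.le, hr2]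
      calc b / a * ‖ξ t‖ ^ 2 ≤ b / a * a ^ 2 := by
            gcongr; exact ha t
        _ = a * b := by field_simp
        _ ≤ C := hab
    · rw [norm_smul, mul_pow, Complex.norm_real, Real.norm_of_nonneg (inv_pos.mpr hr0).le,
        inv_pow, hr2]
      calc (b / a)⁻¹ * ‖η s‖ ^ 2 ≤ (b / a)⁻¹ * b ^ 2 := by
            gcongr; exact hb s
        _ = a * b := by field_simp
        _ ≤ C := hab
    · rw [hφ, inner_smul_left, inner_smul_right, Complex.conj_ofReal, ← mul_assoc,
        ← Complex.ofReal_mul, inv_mul_cancel₀ hr0.ne']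
      simp

theorem IsHerzSchurWith.add {φ ψ : Γ → ℂ} {C D : ℝ} (h : IsHerzSchurWith φ C)
    (k : IsHerzSchurWith ψ D) : IsHerzSchurWith (φ + ψ) (C + D) := by
  have hC := h.nonneg
  have hD := k.nonneg
  obtain ⟨H, _, _, _, ξ, η, hξ, hη, hφ⟩ := h.balanced
  obtain ⟨K, _, _, _, ξ', η', hξ', hη', hψ⟩ := k.balanced
  refine ⟨WithLp 2 (H × K), inferInstance, inferInstance, inferInstance,
    fun t => WithLp.toLp 2 (ξ t, ξ' t), fun s => WithLp.toLp 2 (η s, η' s),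
    Real.sqrt (C + D), Real.sqrt (C + D), fun t => ?_, fun s => ?_, ?_, fun s t => ?_⟩
  · apply Real.le_sqrt_of_sq_le
    rw [WithLp.prod_norm_sq_eq_of_L2]
    exact add_le_add (hξ t) (hξ' t)
  · apply Real.le_sqrt_of_sq_le
    rw [WithLp.prod_norm_sq_eq_of_L2]
    exact add_le_add (hη s) (hη' s)
  · rw [Real.mul_self_sqrt (add_nonneg hC hD)]
  · simp [hφ, hψ, WithLp.prod_inner_apply]

theorem IsHerzSchurWith.single [DecidableEq Γ] (g : Γ) :
    IsHerzSchurWith (Pi.single g (1 : ℂ)) 1 := by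
  refine ⟨lp (fun _ : Γ => ℂ) 2, inferInstance, inferInstance, inferInstance,
    fun t => lp.single 2 (g * t) (1 : ℂ), fun s => lp.single 2 s (1 : ℂ), 1, 1,
    fun t => ?_, fun s => ?_, by simp, fun s t => ?_⟩
  · rw [lp.norm_single (by norm_num)]; simp
  · rw [lp.norm_single (by norm_num)]; simp
  · rw [lp.inner_single_left, lp.single_apply]
    by_cases hst : s = g * t
    · subst hst; simp
    · rw [Pi.single_eq_of_ne, Pi.single_eq_of_ne] <;> simp [hst, mul_inv_eq_iff_eq_mul]

theorem IsHerzSchurWith.one : IsHerzSchurWith (1 : Γ → ℂ) 1 := by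
  classical
  refine ⟨lp (fun _ : Γ => ℂ) 2, inferInstance, inferInstance, inferInstance,
    fun _ => lp.single 2 1 (1 : ℂ), fun _ => lp.single 2 1 (1 : ℂ), 1, 1,
    fun t => ?_, fun s => ?_, by simp, fun s t => ?_⟩
  · rw [lp.norm_single (by norm_num)]; simp
  · rw [lp.norm_single (by norm_num)]; simp
  · rw [lp.inner_single_left, lp.single_apply]; simp

variable (Γ) in
/-- The linear space of Herz–Schur multipliers, inside all functions on `Γ`. -/
def herzSchurSubmodule : Submodule ℂ (Γ → ℂ) where
  carrier := {φ | ∃ C, IsHerzSchurWith φ C}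
  add_mem' := by
    rintro φ ψ ⟨C, hC⟩ ⟨D, hD⟩
    exact ⟨C + D, hC.add hD⟩
  zero_mem' := ⟨0, .zero⟩
  smul_mem' := by
    rintro c φ ⟨C, hC⟩
    exact ⟨‖c‖ * C, hC.smul c⟩

variable (Γ) in
/-- The space `B₂(Γ)` of Herz–Schur multipliers, a type of its own because it carries the
Herz–Schur norm and not a norm or topology inherited from the space of all functions. -/
def HerzSchur : Type u := herzSchurSubmodule Γ

namespace HerzSchur

instance : AddCommGroup (HerzSchur Γ) := inferInstanceAs (AddCommGroup (herzSchurSubmodule Γ))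

instance : Module ℂ (HerzSchur Γ) := inferInstanceAs (Module ℂ (herzSchurSubmodule Γ))

variable (Γ) in
/-- The inclusion of `B₂(Γ)` into the functions on `Γ`. -/
def toFun : HerzSchur Γ →ₗ[ℂ] (Γ → ℂ) := (herzSchurSubmodule Γ).subtype

theorem toFun_injective : Function.Injective (toFun Γ) := Subtype.val_injective

/-- The Herz–Schur norm: the infimum of `sup ‖ξ‖ * sup ‖η‖` over all factorizations. -/
instance : Norm (HerzSchur Γ) := ⟨fun φ => sInf {C | IsHerzSchurWith (toFun Γ φ) C}⟩

theorem norm_def (φ : HerzSchur Γ) : ‖φ‖ = sInf {C | IsHerzSchurWith (toFun Γ φ) C} := rfl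

theorem bddBelow (φ : Γ → ℂ) : BddBelow {C | IsHerzSchurWith φ C} := ⟨0, fun _ h => h.nonneg⟩

theorem exists_bound (φ : HerzSchur Γ) : {C | IsHerzSchurWith (toFun Γ φ) C}.Nonempty := φ.2

theorem norm_le_of {φ : HerzSchur Γ} {C : ℝ} (h : IsHerzSchurWith (toFun Γ φ) C) : ‖φ‖ ≤ C :=
  csInf_le (bddBelow _) h

theorem exists_lt {φ : HerzSchur Γ} {r : ℝ} (h : ‖φ‖ < r) :
    ∃ C, IsHerzSchurWith (toFun Γ φ) C ∧ C < r :=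
  (csInf_lt_iff (bddBelow _) φ.exists_bound).mp h

theorem norm_apply_le (φ : HerzSchur Γ) (g : Γ) : ‖toFun Γ φ g‖ ≤ ‖φ‖ :=
  le_csInf φ.exists_bound fun _ h => IsHerzSchurWith.norm_le h g

theorem norm_smul_le' (c : ℂ) (φ : HerzSchur Γ) : ‖c • φ‖ ≤ ‖c‖ * ‖φ‖ := by
  refine le_of_forall_pos_le_add fun ε hε => ?_
  have h1 : 0 < ‖c‖ + 1 := by positivity
  obtain ⟨C, hC, hlt⟩ := exists_lt (show ‖φ‖ < ‖φ‖ + ε / (‖c‖ + 1) by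
    have : 0 < ε / (‖c‖ + 1) := by positivity
    linarith)
  have h2 : ‖c • φ‖ ≤ ‖c‖ * C := norm_le_of (by rw [map_smul]; exact hC.smul c)
  have h3 : ‖c‖ * (ε / (‖c‖ + 1)) ≤ ε := by
    rw [← mul_div_assoc, div_le_iff₀ h1]
    nlinarith [norm_nonneg c]
  nlinarith [norm_nonneg c, mul_le_mul_of_nonneg_left hlt.le (norm_nonneg c)]

theorem core : NormedSpace.Core ℂ (HerzSchur Γ) where
  norm_nonneg φ := (norm_nonneg _).trans (φ.norm_apply_le 1)
  norm_smul c φ := by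
    refine le_antisymm (norm_smul_le' c φ) ?_
    rcases eq_or_ne c 0 with rfl | hc
    · simpa using (norm_nonneg _).trans (norm_apply_le ((0 : ℂ) • φ) 1)
    · have h := norm_smul_le' c⁻¹ (c • φ)
      rw [inv_smul_smul₀ hc, norm_inv] at h
      have hc' : 0 < ‖c‖ := norm_pos_iff.mpr hc
      calc ‖c‖ * ‖φ‖ ≤ ‖c‖ * (‖c‖⁻¹ * ‖c • φ‖) := mul_le_mul_of_nonneg_left h hc'.le
        _ = ‖c • φ‖ := by rw [← mul_assoc, mul_inv_cancel₀ hc'.ne', one_mul]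
  norm_triangle φ ψ := by
    refine le_of_forall_pos_le_add fun ε hε => ?_
    obtain ⟨C, hC, hlt⟩ := exists_lt (show ‖φ‖ < ‖φ‖ + ε / 2 by linarith)
    obtain ⟨D, hD, hlt'⟩ := exists_lt (show ‖ψ‖ < ‖ψ‖ + ε / 2 by linarith)
    have h2 : ‖φ + ψ‖ ≤ C + D := norm_le_of (by rw [map_add]; exact hC.add hD)
    linarith
  norm_eq_zero_iff φ := by
    constructor
    · intro h
      refine toFun_injective (funext fun g => ?_)
      have := φ.norm_apply_le g
      rw [h] at this
      simpa using norm_le_zero_iff.mp this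
    · rintro rfl
      refine le_antisymm (norm_le_of ?_) ((norm_nonneg _).trans (norm_apply_le 0 1))
      rw [map_zero]
      exact .zero

instance : NormedAddCommGroup (HerzSchur Γ) := .ofCore core

instance : NormedSpace ℂ (HerzSchur Γ) := .ofCore core

/-- The constant function `1`. -/
instance : One (HerzSchur Γ) := ⟨⟨1, 1, .one⟩⟩

variable (Γ) in
/-- Finitely supported functions are Herz–Schur multipliers. -/
def ofFinsupp (f : Γ →₀ ℂ) : HerzSchur Γ :=
  ⟨f, by
    classical
    induction f using Finsupp.induction_linear with
    | zero => exact (herzSchurSubmodule Γ).zero_mem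
    | add f g hf hg => exact (herzSchurSubmodule Γ).add_mem hf hg
    | single g c =>
      have h : (⇑(Finsupp.single g c) : Γ → ℂ) = c • Pi.single g (1 : ℂ) := by
        rw [Finsupp.single_eq_pi_single, ← Pi.single_smul, smul_eq_mul, mul_one]
      rw [h]
      exact (herzSchurSubmodule Γ).smul_mem c ⟨1, .single g⟩⟩

/-- Evaluation at a group element, as a bounded functional on `B₂(Γ)`. -/
def eval (g : Γ) : StrongDual ℂ (HerzSchur Γ) :=
  LinearMap.mkContinuous ((LinearMap.proj g).comp (toFun Γ)) 1 fun φ => by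
    simpa using φ.norm_apply_le g

variable (Γ) in
/-- The canonical predual `Q(Γ)` of `B₂(Γ)`: the completion of the finitely supported functions `f`
in the norm `‖f‖ = sup {|∑ f(s) φ(s)| : ‖φ‖ ≤ 1}`, realized as the norm closure in the dual of
`B₂(Γ)` of the functionals `φ ↦ ∑ f(s) φ(s)`. -/
def predual : Submodule ℂ (StrongDual ℂ (HerzSchur Γ)) :=
  (Submodule.span ℂ (Set.range (eval (Γ := Γ)))).topologicalClosure

end HerzSchur

variable (Γ) in
/-- The approximation property (AP) of a discrete group: there is a net of finitely supported
functions that converges to the constant function `1` in the topology `σ(B₂(Γ), Q(Γ))`. -/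
def HasAP : Prop :=
  ∃ (ι : Type u) (_ : Preorder ι) (_ : IsDirectedOrder ι) (_ : Nonempty ι) (φ : ι → Γ →₀ ℂ),
    ∀ q ∈ HerzSchur.predual Γ,
      Tendsto (fun i => q (HerzSchur.ofFinsupp Γ (φ i))) atTop (𝓝 (q 1))

end ApproximationProperty

/-! ## Reduced crossed products -/

section CrossedProduct

variable {Γ : Type u} {H : Type w} [NormedAddCommGroup H]

variable (Γ H) in
/-- The Hilbert space `ℓ²(Γ, H)`. -/
abbrev EllTwo : Type (max u w) := lp (fun _ : Γ => H) 2

theorem EllTwo.hasSum_norm_sq (ξ : EllTwo Γ H) : HasSum (fun g => ‖ξ g‖ ^ 2) (‖ξ‖ ^ 2) := by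
  have h := lp.hasSum_norm (p := 2) (by norm_num) ξ
  simpa using h

variable [InnerProductSpace ℂ H]

/-- The bounded operator on `ℓ²(Γ, H)` given by a linear map `L` of functions with
`‖L ξ‖₂ ≤ C ‖ξ‖₂`. -/
def EllTwo.mkOp (L : (Γ → H) →ₗ[ℂ] (Γ → H)) (C : ℝ) (hC : 0 ≤ C)
    (hL : ∀ ξ : EllTwo Γ H, ∃ r ≤ C ^ 2 * ‖ξ‖ ^ 2, HasSum (fun g => ‖L ξ g‖ ^ 2) r) :
    EllTwo Γ H →L[ℂ] EllTwo Γ H :=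
  have hmem : ∀ ξ : EllTwo Γ H, Memℓp (L ξ) 2 := fun ξ => by
    obtain ⟨r, -, hr⟩ := hL ξ
    exact memℓp_gen (by simpa using hr.summable)
  let M : EllTwo Γ H →ₗ[ℂ] EllTwo Γ H :=
    { toFun := fun ξ => (⟨L ξ, hmem ξ⟩ : EllTwo Γ H)
      map_add' := fun ξ η => lp.ext (L.map_add ξ η)
      map_smul' := fun c ξ => lp.ext (L.map_smul c ξ) }
  have hM : ∀ ξ : EllTwo Γ H, ‖M ξ‖ ≤ C * ‖ξ‖ := fun ξ => by
    obtain ⟨r, hr, hsum⟩ := hL ξ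
    have h : ‖M ξ‖ ^ 2 = r := (EllTwo.hasSum_norm_sq (M ξ)).unique hsum
    refine le_of_sq_le_sq ?_ (mul_nonneg hC (norm_nonneg _))
    rw [mul_pow, h]
    exact hr
  M.mkContinuous C hM

@[simp]
theorem EllTwo.mkOp_apply (L : (Γ → H) →ₗ[ℂ] (Γ → H)) (C : ℝ) (hC : 0 ≤ C)
    (hL : ∀ ξ : EllTwo Γ H, ∃ r ≤ C ^ 2 * ‖ξ‖ ^ 2, HasSum (fun g => ‖L ξ g‖ ^ 2) r)
    (ξ : EllTwo Γ H) (g : Γ) : EllTwo.mkOp L C hC hL ξ g = L ξ g := rfl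

/-- The operator `(ξ_g)_g ↦ (T_g ξ_g)_g` on `ℓ²(Γ, H)` of a uniformly bounded family `T`. -/
def diagOp (T : Γ → H →L[ℂ] H) (C : ℝ) (hC : 0 ≤ C) (hT : ∀ g, ‖T g‖ ≤ C) :
    EllTwo Γ H →L[ℂ] EllTwo Γ H :=
  EllTwo.mkOp (LinearMap.pi fun g => (T g).toLinearMap.comp (LinearMap.proj g)) C hC fun ξ => by
    have hb : ∀ g : Γ, ‖T g (ξ g)‖ ^ 2 ≤ C ^ 2 * ‖ξ g‖ ^ 2 := fun g => by
      rw [← mul_pow]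
      exact pow_le_pow_left₀ (norm_nonneg _) ((T g).le_of_opNorm_le (hT g) _) 2
    have hs := (EllTwo.hasSum_norm_sq ξ).mul_left (C ^ 2)
    have hsum := Summable.of_nonneg_of_le (fun g => by positivity) hb hs.summable
    exact ⟨_, hasSum_le hb hsum.hasSum hs, hsum.hasSum⟩

@[simp]
theorem diagOp_apply (T : Γ → H →L[ℂ] H) (C : ℝ) (hC : 0 ≤ C) (hT : ∀ g, ‖T g‖ ≤ C)
    (ξ : EllTwo Γ H) (g : Γ) : diagOp T C hC hT ξ g = T g (ξ g) := rfl

variable [Group Γ]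

variable (H) in
/-- The left translation `u_s` on `ℓ²(Γ, H)`: `(u_s ξ)_g = ξ_{s⁻¹ g}`. -/
def translation (s : Γ) : EllTwo Γ H →L[ℂ] EllTwo Γ H :=
  EllTwo.mkOp (LinearMap.funLeft ℂ H fun g => s⁻¹ * g) 1 zero_le_one fun ξ =>
    ⟨‖ξ‖ ^ 2, by simp, (Equiv.mulLeft s⁻¹).hasSum_iff.mpr (EllTwo.hasSum_norm_sq ξ)⟩

@[simp]
theorem translation_apply (s : Γ) (ξ : EllTwo Γ H) (g : Γ) :
    translation H s ξ g = ξ (s⁻¹ * g) := rfl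

theorem translation_mul (s t : Γ) :
    translation H s * translation H t = translation H (s * t) := by
  ext ξ g
  simp [mul_assoc]

variable [CompleteSpace H]

theorem star_translation (s : Γ) : star (translation H s) = translation H s⁻¹ := by
  symm
  refine (ContinuousLinearMap.eq_adjoint_iff _ _).mpr fun ξ η => ?_
  rw [lp.inner_eq_tsum, lp.inner_eq_tsum,
    ← (Equiv.mulLeft s).tsum_eq (fun g => inner ℂ (ξ g) (translation H s η g))]
  simp

variable {A : Type v} [NonUnitalCStarAlgebra A]

/-- The amplification `a ↦ π̃(a)` of a representation `π` of the `Γ`-C⋆-algebra `(A, α)` on `H` to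
a representation on `ℓ²(Γ, H)`: `(π̃(a) ξ)_g = π(α_{g⁻¹}(a)) ξ_g`. -/
def amplify (α : Γ →* (A ≃⋆ₐ[ℂ] A)) (π : A →⋆ₙₐ[ℂ] (H →L[ℂ] H)) (a : A) :
    EllTwo Γ H →L[ℂ] EllTwo Γ H :=
  diagOp (fun g => π (α g⁻¹ a)) ‖a‖ (norm_nonneg a) fun g =>
    (NonUnitalStarAlgHom.norm_apply_le π _).trans (NonUnitalStarAlgHom.norm_apply_le (α g⁻¹) a)

@[simp]
theorem amplify_apply (α : Γ →* (A ≃⋆ₐ[ℂ] A)) (π : A →⋆ₙₐ[ℂ] (H →L[ℂ] H)) (a : A)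
    (ξ : EllTwo Γ H) (g : Γ) : amplify α π a ξ g = π (α g⁻¹ a) (ξ g) := rfl

variable (α : Γ →* (A ≃⋆ₐ[ℂ] A)) (π : A →⋆ₙₐ[ℂ] (H →L[ℂ] H))

theorem amplify_mul (a b : A) : amplify α π a * amplify α π b = amplify α π (a * b) := by
  ext ξ g
  simp

theorem star_amplify (a : A) : star (amplify α π a) = amplify α π (star a) := by
  symm
  refine (ContinuousLinearMap.eq_adjoint_iff _ _).mpr fun ξ η => ?_
  rw [lp.inner_eq_tsum, lp.inner_eq_tsum]
  refine tsum_congr fun g => ?_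
  simp only [amplify_apply, map_star]
  rw [ContinuousLinearMap.star_eq_adjoint, ContinuousLinearMap.adjoint_inner_left]

theorem apply_inv_mul_apply (s g : Γ) (a : A) : α (s⁻¹ * g)⁻¹ a = α g⁻¹ (α s a) := by
  rw [← StarAlgEquiv.mul_apply, ← map_mul, mul_inv_rev, inv_inv]

theorem translation_amplify (s : Γ) (a : A) :
    translation H s * amplify α π a = amplify α π (α s a) * translation H s := by
  ext ξ g
  change π (α (s⁻¹ * g)⁻¹ a) (ξ (s⁻¹ * g)) = π (α g⁻¹ (α s a)) (ξ (s⁻¹ * g))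
  rw [apply_inv_mul_apply]

/-- The linear span of the operators `π̃(a) u_g`, the algebraic crossed product. It is a
⋆-subalgebra of the bounded operators on `ℓ²(Γ, H)`. -/
def algCrossedProduct : NonUnitalStarSubalgebra ℂ (EllTwo Γ H →L[ℂ] EllTwo Γ H) :=
  let S : Submodule ℂ (EllTwo Γ H →L[ℂ] EllTwo Γ H) :=
    Submodule.span ℂ {T | ∃ (a : A) (g : Γ), T = amplify α π a * translation H g}
  { S with
    mul_mem' := by
      intro x y hx hy
      change x ∈ S at hx
      change y ∈ S at hy
      change x * y ∈ S
      induction hx, hy using Submodule.span_induction₂ with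
      | mem_mem x y hx hy =>
        obtain ⟨a, s, rfl⟩ := hx
        obtain ⟨b, t, rfl⟩ := hy
        refine Submodule.subset_span ⟨a * α s b, s * t, ?_⟩
        rw [← amplify_mul, ← translation_mul, mul_assoc, mul_assoc, ← mul_assoc (translation H s),
          translation_amplify, mul_assoc]
      | zero_left y hy => simp
      | zero_right x hx => simp
      | add_left x y z _ _ _ h1 h2 => rw [add_mul]; exact S.add_mem h1 h2
      | add_right x y z _ _ _ h1 h2 => rw [mul_add]; exact S.add_mem h1 h2
      | smul_left r x y _ _ h => rw [smul_mul_assoc]; exact S.smul_mem r h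
      | smul_right r x y _ _ h => rw [mul_smul_comm]; exact S.smul_mem r h
    star_mem' := by
      intro x hx
      change x ∈ S at hx
      change star x ∈ S
      induction hx using Submodule.span_induction with
      | mem x hx =>
        obtain ⟨a, s, rfl⟩ := hx
        refine Submodule.subset_span ⟨α s⁻¹ (star a), s⁻¹, ?_⟩
        rw [star_mul, star_translation, star_amplify, translation_amplify]
      | zero => simp
      | add x y _ _ h1 h2 => rw [star_add]; exact S.add_mem h1 h2
      | smul c x _ h => rw [star_smul]; exact S.smul_mem _ h }

theorem mem_algCrossedProduct {x : EllTwo Γ H →L[ℂ] EllTwo Γ H} :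
    x ∈ algCrossedProduct α π ↔
      x ∈ Submodule.span ℂ {T | ∃ (a : A) (g : Γ), T = amplify α π a * translation H g} :=
  Iff.rfl

/-- The reduced crossed product `A ⋊ Γ` of the `Γ`-C⋆-algebra `(A, α)`, as the C⋆-algebra of
operators on `ℓ²(Γ, H)` that it is through a faithful representation `π` of `A` on `H`. -/
def reducedCrossedProduct : NonUnitalStarSubalgebra ℂ (EllTwo Γ H →L[ℂ] EllTwo Γ H) :=
  (algCrossedProduct α π).topologicalClosure

theorem mem_reducedCrossedProduct {x : EllTwo Γ H →L[ℂ] EllTwo Γ H} :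
    x ∈ reducedCrossedProduct α π ↔
      x ∈ closure (algCrossedProduct α π : Set (EllTwo Γ H →L[ℂ] EllTwo Γ H)) :=
  Iff.rfl

/-- `A ⋊ Γ` is stable under right multiplication by `u_g⋆`. -/
theorem mul_star_translation_mem {x : EllTwo Γ H →L[ℂ] EllTwo Γ H}
    (hx : x ∈ reducedCrossedProduct α π) (g : Γ) :
    x * star (translation H g) ∈ reducedCrossedProduct α π := by
  rw [mem_reducedCrossedProduct] at hx ⊢
  refine map_mem_closure (f := fun y => y * star (translation H g)) (by fun_prop) hx fun y hy => ?_
  rw [SetLike.mem_coe, mem_algCrossedProduct] at hy ⊢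
  beta_reduce
  induction hy using Submodule.span_induction with
  | mem x hx =>
    obtain ⟨a, s, rfl⟩ := hx
    refine Submodule.subset_span ⟨a, s * g⁻¹, ?_⟩
    rw [star_translation, mul_assoc, translation_mul]
  | zero => simp
  | add x y _ _ h1 h2 => rw [add_mul]; exact Submodule.add_mem _ h1 h2
  | smul c x _ h => rw [smul_mul_assoc]; exact Submodule.smul_mem _ _ h

open Classical in
/-- The compression `V⋆ x V` of an operator on `ℓ²(Γ, H)` to the copy `δ_1 ⊗ H` of `H`, where
`V ξ = δ_1 ⊗ ξ`. -/
def compression : (EllTwo Γ H →L[ℂ] EllTwo Γ H) →L[ℂ] (H →L[ℂ] H) :=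
  (ContinuousLinearMap.compL ℂ H (EllTwo Γ H) H (lp.evalCLM ℂ (fun _ : Γ => H) 2 1)).comp
    ((ContinuousLinearMap.compL ℂ H (EllTwo Γ H) (EllTwo Γ H)).flip
      (lp.singleContinuousLinearMap ℂ (fun _ : Γ => H) 2 1))

open Classical in
@[simp]
theorem compression_apply (x : EllTwo Γ H →L[ℂ] EllTwo Γ H) (ξ : H) :
    compression x ξ = x (lp.single 2 (1 : Γ) ξ) 1 := rfl

open Classical in
theorem compression_generator (a : A) (g : Γ) :
    compression (amplify α π a * translation H g) = π (if g = 1 then a else 0) := by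
  ext ξ
  by_cases hg : g = 1
  · subst hg; simp
  · have : g⁻¹ ≠ 1 := by simpa using hg
    simp [hg, this]

/-- The compression of an element of `A ⋊ Γ` lies in `π(A)`. -/
theorem exists_eq_compression (hπ : Function.Injective π) {x : EllTwo Γ H →L[ℂ] EllTwo Γ H}
    (hx : x ∈ reducedCrossedProduct α π) : ∃ a : A, π a = compression x := by
  classical
  have hcl : IsClosed (Set.range π) :=
    (NonUnitalStarAlgHom.isometry π hπ).isClosedEmbedding.isClosed_range
  have h : compression x ∈ closure (Set.range π) := by
    rw [mem_reducedCrossedProduct] at hx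
    refine map_mem_closure (compression (Γ := Γ) (H := H)).continuous hx fun y hy => ?_
    rw [SetLike.mem_coe, mem_algCrossedProduct] at hy
    induction hy using Submodule.span_induction with
    | mem x hx =>
      obtain ⟨a, g, rfl⟩ := hx
      exact ⟨_, (compression_generator α π a g).symm⟩
    | zero => exact ⟨0, by simp⟩
    | add x y _ _ h1 h2 =>
      obtain ⟨a, ha⟩ := h1
      obtain ⟨b, hb⟩ := h2
      exact ⟨a + b, by rw [map_add, map_add, ha, hb]⟩
    | smul c x _ h =>
      obtain ⟨a, ha⟩ := h
      exact ⟨c • a, by rw [map_smul, map_smul, ha]⟩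
  rwa [hcl.closure_eq] at h

/-- The canonical conditional expectation `E : A ⋊ Γ → A`, with `E(∑ a_g u_g) = a_1`. -/
def canonicalExpectation (hπ : Function.Injective π) (x : reducedCrossedProduct α π) : A :=
  (exists_eq_compression α π hπ x.2).choose

theorem map_canonicalExpectation (hπ : Function.Injective π) (x : reducedCrossedProduct α π) :
    π (canonicalExpectation α π hπ x) = compression x.1 :=
  (exists_eq_compression α π hπ x.2).choose_spec

/-- The `g`-th Fourier coefficient `E_g(x) = E(x u_g⋆)` of `x ∈ A ⋊ Γ`. -/
def crossedCoeff (hπ : Function.Injective π) (g : Γ) (x : reducedCrossedProduct α π) : A :=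
  canonicalExpectation α π hπ
    ⟨x.1 * star (translation H g), mul_star_translation_mem α π x.2 g⟩

/-- The restriction of a group action to an invariant ⋆-subalgebra. -/
def restrictAction (B : NonUnitalStarSubalgebra ℂ A) (hB : ∀ (g : Γ), ∀ b ∈ B, α g b ∈ B) :
    Γ →* (B ≃⋆ₐ[ℂ] B) where
  toFun g :=
    { toFun := fun b => ⟨α g b, hB g b b.2⟩
      invFun := fun b => ⟨α g⁻¹ b, hB g⁻¹ b b.2⟩
      left_inv := fun b => Subtype.ext (by
        change α _ (α _ _) = _
        rw [← StarAlgEquiv.mul_apply, ← map_mul, inv_mul_cancel, map_one]; rfl)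
      right_inv := fun b => Subtype.ext (by
        change α _ (α _ _) = _
        rw [← StarAlgEquiv.mul_apply, ← map_mul, mul_inv_cancel, map_one]; rfl)
      map_mul' := fun a b => Subtype.ext (by simp)
      map_add' := fun a b => Subtype.ext (by simp)
      map_star' := fun a => Subtype.ext (by simp [map_star])
      map_smul' := fun c a => Subtype.ext (by simp) }
  map_one' := by ext b; simp
  map_mul' g h := by ext b; simp

end CrossedProduct

end

/-! # Elements of a reduced crossed product with coefficients in a subalgebra

Every Herz–Schur multiplier `φ` acts on the operators on `ℓ²(Γ, H)` by Schur multiplication: `M_φ x`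
has the matrix entries `φ (s t⁻¹) x_{s,t}`. If `φ (s t⁻¹) = ⟨η s, ξ t⟩`, then
`M_φ x = W_η⋆ (1 ⊗ x) W_ξ` with `W_ξ : δ_t ⊗ h ↦ ξ_t ⊗ δ_t ⊗ h`, whence `‖M_φ x‖ ≤ ‖φ‖ ‖x‖`
(`exists_isSchurProduct`, `norm_schurMulLin_le`).

Two facts about an element `x` of `A ⋊ Γ` carry the argument.

* For every bounded functional `f`, the functional `φ ↦ f (M_φ x)` belongs to the predual `Q(Γ)`
  (`comp_schurMul_mem_predual`). Indeed `M_φ (π̃(a) u_g) = φ(g) π̃(a) u_g`, so for `x` in the linear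
  span of the operators `π̃(a) u_g` it is a combination of evaluations, and the norm estimate
  extends the claim to the closure.
* If `φ` is finitely supported, then `M_φ x = ∑_g φ(g) π̃(E_g(x)) u_g` (`schurMul_ofFinsupp`),
  because the matrix entries of `x` are determined by its Fourier coefficients (`matrixEntry_eq`).

Let `φ_i → 1` be as in the approximation property. By the first fact `M_{φ_i} x → M_1 x = x` weakly,
and by the second one `M_{φ_i} x` lies in `B ⋊ Γ` as soon as all `E_g(x)` lie in `B`. Since `B ⋊ Γ`
is a closed subspace, it is weakly closed by the Hahn–Banach theorem, so it contains `x`. -/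

/-! ### Matrix entries of operators on `ℓ²(Γ, H)` -/

section MatrixEntry

variable {Γ : Type u} {H : Type w} [NormedAddCommGroup H] [InnerProductSpace ℂ H]

open Classical in
/-- The matrix entry `x_{s,t}` of an operator `x` on `ℓ²(Γ, H)`, a bounded operator on `H`. -/
noncomputable def matrixEntry (s t : Γ) : (EllTwo Γ H →L[ℂ] EllTwo Γ H) →L[ℂ] (H →L[ℂ] H) :=
  ((ContinuousLinearMap.compL ℂ H (EllTwo Γ H) H) (lp.evalCLM ℂ (fun _ : Γ => H) 2 s)).comp
    ((ContinuousLinearMap.compL ℂ H (EllTwo Γ H) (EllTwo Γ H)).flip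
      (lp.singleContinuousLinearMap ℂ (fun _ : Γ => H) 2 t))

open Classical in
theorem matrixEntry_apply (s t : Γ) (x : EllTwo Γ H →L[ℂ] EllTwo Γ H) (h : H) :
    matrixEntry s t x h = x (lp.single 2 t h) s := rfl

theorem ext_matrixEntry {x y : EllTwo Γ H →L[ℂ] EllTwo Γ H}
    (hxy : ∀ s t, matrixEntry s t x = matrixEntry s t y) : x = y := by
  classical
  ext1 ζ
  have hζ := lp.hasSum_single (p := 2) (by norm_num) ζ
  refine (x.hasSum hζ).unique ?_
  convert y.hasSum hζ using 1
  funext t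
  refine lp.ext (funext fun s => ?_)
  exact DFunLike.congr_fun (hxy s t) (ζ t)

end MatrixEntry

/-! ### Schur multiplication by Herz–Schur multipliers -/

section SchurMultiplication

variable {Γ : Type u} {H : Type w} [NormedAddCommGroup H] [InnerProductSpace ℂ H]

section Dilation

variable {K : Type u} [NormedAddCommGroup K] [InnerProductSpace ℂ K] {I : Type u}

/-- The `i`-th coordinate of `W_ξ` in an orthonormal family `e`: multiplication of `ζ ∈ ℓ²(Γ, H)` by
the function `t ↦ ⟨e_i, ξ_t⟩`. -/
noncomputable def coordMul {e : I → K} (he : Orthonormal ℂ e) (ξ : Γ → K) {a : ℝ} (ha : 0 ≤ a)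
    (hξ : ∀ t, ‖ξ t‖ ≤ a) (i : I) : EllTwo Γ H →L[ℂ] EllTwo Γ H :=
  diagOp (fun t => (inner ℂ (e i) (ξ t)) • ContinuousLinearMap.id ℂ H) a ha fun t => by
    rw [norm_smul]
    calc ‖inner ℂ (e i) (ξ t)‖ * ‖ContinuousLinearMap.id ℂ H‖ ≤ (‖e i‖ * ‖ξ t‖) * 1 :=
          mul_le_mul (norm_inner_le_norm _ _) ContinuousLinearMap.norm_id_le (norm_nonneg _)
            (by positivity)
      _ ≤ a := by rw [he.1 i, one_mul, mul_one]; exact hξ t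

theorem coordMul_apply {e : I → K} (he : Orthonormal ℂ e) (ξ : Γ → K) {a : ℝ} (ha : 0 ≤ a)
    (hξ : ∀ t, ‖ξ t‖ ≤ a) (i : I) (ζ : EllTwo Γ H) (t : Γ) :
    coordMul he ξ ha hξ i ζ t = inner ℂ (e i) (ξ t) • ζ t := rfl

theorem coordMul_single [DecidableEq Γ] {e : I → K} (he : Orthonormal ℂ e) (ξ : Γ → K) {a : ℝ}
    (ha : 0 ≤ a) (hξ : ∀ t, ‖ξ t‖ ≤ a) (i : I) (t : Γ) (h : H) :
    coordMul he ξ ha hξ i (lp.single 2 t h) =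
      inner ℂ (e i) (ξ t) • (lp.single 2 t h : EllTwo Γ H) := by
  refine lp.ext (funext fun s => ?_)
  rw [coordMul_apply, lp.coeFn_smul, Pi.smul_apply]
  by_cases hst : s = t
  · subst hst; rfl
  · simp [lp.single_apply, Pi.single_eq_of_ne hst]

/-- Bessel's inequality, applied to each `ξ_t`. -/
theorem sum_norm_coordMul_sq_le {e : I → K} (he : Orthonormal ℂ e) (ξ : Γ → K) {a : ℝ} (ha : 0 ≤ a)
    (hξ : ∀ t, ‖ξ t‖ ≤ a) (ζ : EllTwo Γ H) (F : Finset I) :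
    ∑ i ∈ F, ‖coordMul he ξ ha hξ i ζ‖ ^ 2 ≤ (a * ‖ζ‖) ^ 2 := by
  have h1 := hasSum_sum (s := F) fun i _ => EllTwo.hasSum_norm_sq (coordMul he ξ ha hξ i ζ)
  have h2 := (EllTwo.hasSum_norm_sq ζ).mul_left (a ^ 2)
  rw [mul_pow]
  refine hasSum_le (fun t => ?_) h1 h2
  simp only [coordMul_apply, norm_smul, mul_pow]
  rw [← Finset.sum_mul]
  refine mul_le_mul_of_nonneg_right ?_ (by positivity)
  exact (he.sum_inner_products_le (ξ t)).trans (pow_le_pow_left₀ (norm_nonneg _) (hξ t) 2)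

/-- The operator `W_ξ : ℓ²(Γ, H) → K ⊗ ℓ²(Γ, H)` with `W_ξ (δ_t ⊗ h) = ξ_t ⊗ δ_t ⊗ h`. The tensor
product with `K` is encoded as `ℓ²(I, ·)` by means of an orthonormal family indexed by `I`. -/
noncomputable def dilation {e : I → K} (he : Orthonormal ℂ e) (ξ : Γ → K) {a : ℝ} (ha : 0 ≤ a)
    (hξ : ∀ t, ‖ξ t‖ ≤ a) : EllTwo Γ H →L[ℂ] EllTwo I (EllTwo Γ H) :=
  LinearMap.mkContinuous
    { toFun := fun ζ => (⟨fun i => coordMul he ξ ha hξ i ζ, memℓp_gen' fun F => by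
        simpa using sum_norm_coordMul_sq_le he ξ ha hξ ζ F⟩ : EllTwo I (EllTwo Γ H))
      map_add' := fun ζ ω => lp.ext (funext fun i => map_add (coordMul he ξ ha hξ i) ζ ω)
      map_smul' := fun c ζ => lp.ext (funext fun i => map_smul (coordMul he ξ ha hξ i) c ζ) }
    a fun ζ => lp.norm_le_of_forall_sum_le (by norm_num) (by positivity) fun F => by
      simpa using sum_norm_coordMul_sq_le he ξ ha hξ ζ F

theorem norm_dilation_le {e : I → K} (he : Orthonormal ℂ e) (ξ : Γ → K) {a : ℝ} (ha : 0 ≤ a)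
    (hξ : ∀ t, ‖ξ t‖ ≤ a) : ‖dilation (H := H) he ξ ha hξ‖ ≤ a :=
  LinearMap.mkContinuous_norm_le _ ha _

end Dilation

variable [Group Γ]

/-- `T` is the Schur product of `x` with the matrix `φ (s t⁻¹)`. -/
def IsSchurProduct (φ : Γ → ℂ) (x T : EllTwo Γ H →L[ℂ] EllTwo Γ H) : Prop :=
  ∀ s t, matrixEntry s t T = φ (s * t⁻¹) • matrixEntry s t x

theorem IsSchurProduct.unique {φ : Γ → ℂ} {x T T' : EllTwo Γ H →L[ℂ] EllTwo Γ H}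
    (h : IsSchurProduct φ x T) (h' : IsSchurProduct φ x T') : T = T' :=
  ext_matrixEntry fun s t => (h s t).trans (h' s t).symm

variable [CompleteSpace H]

/-- The Schur product is `W_η⋆ (1 ⊗ x) W_ξ`, where `1 ⊗ x` is the constant diagonal operator. -/
theorem exists_isSchurProduct {φ : Γ → ℂ} {C : ℝ} (hφ : IsHerzSchurWith φ C)
    (x : EllTwo Γ H →L[ℂ] EllTwo Γ H) : ∃ T, IsSchurProduct φ x T ∧ ‖T‖ ≤ C * ‖x‖ := by
  classical
  obtain ⟨K, _, _, _, ξ, η, a, b, hξ, hη, hab, hφ⟩ := hφ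
  have ha : 0 ≤ a := (norm_nonneg _).trans (hξ 1)
  have hb : 0 ≤ b := (norm_nonneg _).trans (hη 1)
  obtain ⟨I, e, -⟩ := exists_hilbertBasis ℂ K
  have he := e.orthonormal
  let X : EllTwo I (EllTwo Γ H) →L[ℂ] EllTwo I (EllTwo Γ H) :=
    diagOp (fun _ => x) ‖x‖ (norm_nonneg x) fun _ => le_rfl
  have hX : ‖X‖ ≤ ‖x‖ := by
    unfold X diagOp EllTwo.mkOp
    exact LinearMap.mkContinuous_norm_le _ (norm_nonneg x) _
  refine ⟨(ContinuousLinearMap.adjoint (dilation he η hb hη)).comp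
    (X.comp (dilation he ξ ha hξ)), fun s t => ?_, ?_⟩
  · ext h
    refine ext_inner_left ℂ fun k => ?_
    have key : ∀ i, inner ℂ (dilation he η hb hη (lp.single 2 s k) i)
        (X (dilation he ξ ha hξ (lp.single 2 t h)) i) =
        (inner ℂ (η s) (e i) * inner ℂ (e i) (ξ t)) * inner ℂ k (matrixEntry s t x h) := by
      intro i
      change inner ℂ (coordMul he η hb hη i (lp.single 2 s k))
        (x (coordMul he ξ ha hξ i (lp.single 2 t h))) = _
      rw [coordMul_single, coordMul_single, map_smul, inner_smul_left, inner_smul_right,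
        inner_conj_symm, lp.inner_single_left, mul_assoc, matrixEntry_apply]
    refine (lp.inner_single_left (𝕜 := ℂ) (G := fun _ : Γ => H) s k _).symm.trans ?_
    refine (ContinuousLinearMap.adjoint_inner_right (dilation he η hb hη) (lp.single 2 s k)
      (X (dilation he ξ ha hξ (lp.single 2 t h)))).trans ?_
    rw [lp.inner_eq_tsum, tsum_congr key, tsum_mul_right, e.tsum_inner_mul_inner,
      smul_apply, inner_smul_right, hφ]
  · calc _ ≤ ‖ContinuousLinearMap.adjoint (dilation (H := H) he η hb hη)‖ *
          (‖X‖ * ‖dilation (H := H) he ξ ha hξ‖) :=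
        (ContinuousLinearMap.opNorm_comp_le _ _).trans
          (mul_le_mul_of_nonneg_left (ContinuousLinearMap.opNorm_comp_le _ _) (norm_nonneg _))
      _ ≤ b * (‖x‖ * a) := by
        rw [LinearIsometryEquiv.norm_map]
        gcongr
        · exact norm_dilation_le he η hb hη
        · exact norm_dilation_le he ξ ha hξ
      _ = (a * b) * ‖x‖ := by ring
      _ ≤ C * ‖x‖ := mul_le_mul_of_nonneg_right hab (norm_nonneg _)

theorem exists_isSchurProduct_toFun (φ : HerzSchur Γ) (x : EllTwo Γ H →L[ℂ] EllTwo Γ H) :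
    ∃ T, IsSchurProduct (HerzSchur.toFun Γ φ) x T := by
  obtain ⟨C, hC⟩ := φ.exists_bound
  obtain ⟨T, hT, -⟩ := exists_isSchurProduct hC x
  exact ⟨T, hT⟩

/-- The operator `M_φ x` on `ℓ²(Γ, H)` with matrix entries `φ (s t⁻¹) x_{s,t}`, as a bilinear map in
`(x, φ)`. -/
noncomputable def schurMulLin : (EllTwo Γ H →L[ℂ] EllTwo Γ H) →ₗ[ℂ] HerzSchur Γ →ₗ[ℂ]
    (EllTwo Γ H →L[ℂ] EllTwo Γ H) :=
  have spec := fun (φ : HerzSchur Γ) (x : EllTwo Γ H →L[ℂ] EllTwo Γ H) =>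
    (exists_isSchurProduct_toFun φ x).choose_spec
  LinearMap.mk₂ ℂ (fun x φ => (exists_isSchurProduct_toFun φ x).choose)
    (fun x y φ => (spec φ (x + y)).unique fun s t => by
      rw [map_add, map_add, smul_add, spec φ x s t, spec φ y s t])
    (fun c x φ => (spec φ (c • x)).unique fun s t => by
      rw [map_smul, map_smul, spec φ x s t, smul_comm])
    (fun x φ ψ => (spec (φ + ψ) x).unique fun s t => by
      rw [map_add, map_add, Pi.add_apply, add_smul, spec φ x s t, spec ψ x s t])
    (fun c x φ => (spec (c • φ) x).unique fun s t => by
      rw [map_smul, map_smul, Pi.smul_apply, smul_assoc, spec φ x s t])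

theorem isSchurProduct_schurMulLin (x : EllTwo Γ H →L[ℂ] EllTwo Γ H) (φ : HerzSchur Γ) :
    IsSchurProduct (HerzSchur.toFun Γ φ) x (schurMulLin x φ) :=
  (exists_isSchurProduct_toFun φ x).choose_spec

theorem norm_schurMulLin_le (x : EllTwo Γ H →L[ℂ] EllTwo Γ H) (φ : HerzSchur Γ) :
    ‖schurMulLin x φ‖ ≤ 1 * ‖x‖ * ‖φ‖ := by
  have h : ∀ C, IsHerzSchurWith (HerzSchur.toFun Γ φ) C → ‖schurMulLin x φ‖ ≤ C * ‖x‖ := by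
    intro C hC
    obtain ⟨T, hT, hle⟩ := exists_isSchurProduct hC x
    rwa [(isSchurProduct_schurMulLin x φ).unique hT]
  refine le_of_forall_pos_le_add fun ε hε => ?_
  have hx : 0 < ‖x‖ + 1 := by positivity
  obtain ⟨C, hC, hlt⟩ := HerzSchur.exists_lt (lt_add_of_pos_right ‖φ‖ (div_pos hε hx))
  calc ‖schurMulLin x φ‖ ≤ C * ‖x‖ := h C hC
    _ ≤ (‖φ‖ + ε / (‖x‖ + 1)) * ‖x‖ := by gcongr
    _ = 1 * ‖x‖ * ‖φ‖ + ε * (‖x‖ / (‖x‖ + 1)) := by ring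
    _ ≤ 1 * ‖x‖ * ‖φ‖ + ε * 1 := by
      gcongr
      exact div_le_one_of_le₀ (by linarith) hx.le
    _ = 1 * ‖x‖ * ‖φ‖ + ε := by rw [mul_one]

/-- The bounded bilinear map `(x, φ) ↦ M_φ x`. -/
noncomputable def schurMul : (EllTwo Γ H →L[ℂ] EllTwo Γ H) →L[ℂ] HerzSchur Γ →L[ℂ]
    (EllTwo Γ H →L[ℂ] EllTwo Γ H) :=
  LinearMap.mkContinuous₂ (schurMulLin (Γ := Γ) (H := H)) 1 fun x φ => norm_schurMulLin_le x φ

theorem isSchurProduct_schurMul (x : EllTwo Γ H →L[ℂ] EllTwo Γ H) (φ : HerzSchur Γ) :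
    IsSchurProduct (HerzSchur.toFun Γ φ) x (schurMul x φ) :=
  isSchurProduct_schurMulLin x φ

theorem schurMul_one (x : EllTwo Γ H →L[ℂ] EllTwo Γ H) : schurMul x (1 : HerzSchur Γ) = x :=
  (isSchurProduct_schurMul x 1).unique fun s t => (one_smul ℂ (matrixEntry s t x)).symm

end SchurMultiplication

/-! ### Schur multiplication on the crossed product -/

section CrossedProductMultiplier

variable {Γ : Type u} {H : Type w} [NormedAddCommGroup H] [InnerProductSpace ℂ H]
  [Group Γ] [CompleteSpace H] {A : Type v} [NonUnitalCStarAlgebra A]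
  (α : Γ →* (A ≃⋆ₐ[ℂ] A)) (π : A →⋆ₙₐ[ℂ] (H →L[ℂ] H))

open Classical in
theorem matrixEntry_generator (a : A) (g s t : Γ) :
    matrixEntry s t (amplify α π a * translation H g) =
      if s * t⁻¹ = g then π (α s⁻¹ a) else 0 := by
  ext h
  rw [matrixEntry_apply, mul_apply_eq_comp, amplify_apply, translation_apply,
    lp.single_apply]
  by_cases hg : s * t⁻¹ = g
  · subst hg
    simp
  · have : g⁻¹ * s ≠ t := fun h' => hg (by rw [← h']; group)
    simp [hg, Pi.single_eq_of_ne this]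

theorem schurMul_generator (a : A) (g : Γ) (φ : HerzSchur Γ) :
    schurMul (amplify α π a * translation H g) φ =
      HerzSchur.toFun Γ φ g • (amplify α π a * translation H g) := by
  classical
  refine (isSchurProduct_schurMul _ φ).unique fun s t => ?_
  rw [map_smul, matrixEntry_generator]
  split_ifs with hg
  · rw [hg]
  · rw [smul_zero, smul_zero]

/-- For `x ∈ A ⋊ Γ`, the functional `φ ↦ f (M_φ x)` is continuous for `σ(B₂(Γ), Q(Γ))`. -/
theorem comp_schurMul_mem_predual {x : EllTwo Γ H →L[ℂ] EllTwo Γ H}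
    (hx : x ∈ reducedCrossedProduct α π) (f : StrongDual ℂ (EllTwo Γ H →L[ℂ] EllTwo Γ H)) :
    f.comp (schurMul x) ∈ HerzSchur.predual Γ := by
  rw [mem_reducedCrossedProduct] at hx
  refine map_mem_closure (f := fun y => f.comp (schurMul y)) (by fun_prop) hx fun y hy => ?_
  rw [SetLike.mem_coe, mem_algCrossedProduct] at hy
  beta_reduce
  induction hy using Submodule.span_induction with
  | mem y hy =>
    obtain ⟨a, g, rfl⟩ := hy
    have h : f.comp (schurMul (amplify α π a * translation H g)) =
        f (amplify α π a * translation H g) • HerzSchur.eval g := by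
      ext φ
      rw [ContinuousLinearMap.comp_apply, schurMul_generator, map_smul, smul_eq_mul, mul_comm]
      rfl
    rw [h]
    exact Submodule.smul_mem _ _ (Submodule.subset_span ⟨g, rfl⟩)
  | zero => simp
  | add y z _ _ hy hz =>
    rw [map_add, ContinuousLinearMap.comp_add]
    exact Submodule.add_mem _ hy hz
  | smul c y _ hy =>
    rw [map_smul, ContinuousLinearMap.comp_smul]
    exact Submodule.smul_mem _ c hy

/-! ### Fourier coefficients -/

/-- A matrix entry and the Fourier coefficient of an element of `A ⋊ Γ` come from the same element
of `A`. The pairs `(π(a), π(α_{s⁻¹}(a)))` form a closed set, so it is enough to look at the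
generators. -/
theorem exists_eq_compression_and_matrixEntry (hπ : Function.Injective π)
    {x : EllTwo Γ H →L[ℂ] EllTwo Γ H} (hx : x ∈ reducedCrossedProduct α π) (s t : Γ) :
    ∃ a : A, π a = compression (x * star (translation H (s * t⁻¹))) ∧
      π (α s⁻¹ a) = matrixEntry s t x := by
  classical
  let ρ : A →⋆ₙₐ[ℂ] (H →L[ℂ] H) × (H →L[ℂ] H) :=
    π.prod (π.comp (α s⁻¹ : A →⋆ₙₐ[ℂ] A))
  have hρ : Function.Injective ρ := fun a b h => hπ (congrArg Prod.fst h)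
  have hcl : IsClosed (Set.range ρ) :=
    (NonUnitalStarAlgHom.isometry ρ hρ).isClosedEmbedding.isClosed_range
  have h : (compression (x * star (translation H (s * t⁻¹))), matrixEntry s t x) ∈
      closure (Set.range ρ) := by
    rw [mem_reducedCrossedProduct] at hx
    refine map_mem_closure (f := fun y =>
      (compression (y * star (translation H (s * t⁻¹))), matrixEntry s t y)) (by fun_prop) hx
      fun y hy => ?_
    rw [SetLike.mem_coe, mem_algCrossedProduct] at hy
    beta_reduce
    induction hy using Submodule.span_induction with
    | mem y hy =>
      obtain ⟨a, g, rfl⟩ := hy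
      refine ⟨if s * t⁻¹ = g then a else 0, ?_⟩
      rw [star_translation, mul_assoc, translation_mul, compression_generator,
        matrixEntry_generator]
      by_cases hg : s * t⁻¹ = g
      · subst hg
        simp only [mul_inv_cancel, if_true]
        rfl
      · have hg' : g * (s * t⁻¹)⁻¹ ≠ 1 := fun h' => hg (mul_inv_eq_one.mp h').symm
        simp only [hg, hg', if_false, map_zero]
        rfl
    | zero => exact ⟨0, by simp; rfl⟩
    | add y z _ _ hy hz =>
      obtain ⟨a, ha⟩ := hy
      obtain ⟨b, hb⟩ := hz
      exact ⟨a + b, by rw [map_add, add_mul, map_add, map_add, ha, hb]; rfl⟩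
    | smul c y _ hy =>
      obtain ⟨a, ha⟩ := hy
      exact ⟨c • a, by rw [map_smul, smul_mul_assoc, map_smul, map_smul, ha]; rfl⟩
  rw [hcl.closure_eq] at h
  obtain ⟨a, ha⟩ := h
  exact ⟨a, congrArg Prod.fst ha, congrArg Prod.snd ha⟩

/-- The matrix entries of an element of `A ⋊ Γ` in terms of its Fourier coefficients. -/
theorem matrixEntry_eq (hπ : Function.Injective π) (x : reducedCrossedProduct α π) (s t : Γ) :
    matrixEntry s t x.1 = π (α s⁻¹ (crossedCoeff α π hπ (s * t⁻¹) x)) := by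
  obtain ⟨a, ha, hent⟩ := exists_eq_compression_and_matrixEntry α π hπ x.2 s t
  have h : crossedCoeff α π hπ (s * t⁻¹) x = a :=
    hπ ((map_canonicalExpectation α π hπ _).trans ha.symm)
  rw [h, hent]

theorem schurMul_ofFinsupp (hπ : Function.Injective π) (x : reducedCrossedProduct α π)
    (φ : Γ →₀ ℂ) :
    schurMul x.1 (HerzSchur.ofFinsupp Γ φ) =
      φ.sum fun g c => c • (amplify α π (crossedCoeff α π hπ g x) * translation H g) := by
  classical
  refine (isSchurProduct_schurMul x.1 _).unique fun s t => ?_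
  change _ = φ (s * t⁻¹) • _
  rw [Finsupp.sum, map_sum, matrixEntry_eq α π hπ x s t]
  simp only [map_smul, matrixEntry_generator, smul_ite, smul_zero]
  rw [Finset.sum_ite_eq]
  split_ifs with h
  · rfl
  · rw [Finsupp.notMem_support_iff.mp h, zero_smul]

end CrossedProductMultiplier

/-! ### Membership in the crossed product by an invariant subalgebra -/

theorem proposition2 {Γ : Type u} [Group Γ] (hΓ : HasAP Γ)
    {A : Type v} [NonUnitalCStarAlgebra A] (α : Γ →* (A ≃⋆ₐ[ℂ] A))
    (B : NonUnitalStarSubalgebra ℂ A) [IsClosed (B : Set A)]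
    (hB : ∀ (g : Γ), ∀ b ∈ B, α g b ∈ B)
    {H : Type w} [NormedAddCommGroup H] [InnerProductSpace ℂ H] [CompleteSpace H]
    (π : A →⋆ₙₐ[ℂ] (H →L[ℂ] H)) (hπ : Function.Injective π)
    (x : reducedCrossedProduct α π)
    (hx : ∀ g : Γ, crossedCoeff α π hπ g x ∈ B) :
    (x : EllTwo Γ H →L[ℂ] EllTwo Γ H) ∈
      reducedCrossedProduct (restrictAction α B hB)
        (π.comp (NonUnitalStarSubalgebraClass.subtype B)) := by
  have hgen : ∀ g, amplify α π (crossedCoeff α π hπ g x) * translation H g ∈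
      algCrossedProduct (restrictAction α B hB)
        (π.comp (NonUnitalStarSubalgebraClass.subtype B)) := fun g =>
    Submodule.subset_span ⟨⟨crossedCoeff α π hπ g x, hx g⟩, g, rfl⟩
  by_contra hmem
  rw [mem_reducedCrossedProduct] at hmem
  -- A bounded functional separates `x` from the closed convex set `B ⋊ Γ`.
  obtain ⟨f, r, hfx, hf⟩ := RCLike.geometric_hahn_banach_point_closed (𝕜 := ℂ)
    ((algCrossedProduct (restrictAction α B hB)
      (π.comp (NonUnitalStarSubalgebraClass.subtype B))).toSubmodule.restrictScalars ℝ
        |>.convex.closure) isClosed_closure hmem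
  obtain ⟨ι, _, _, _, φ, hφ⟩ := hΓ
  have hlim := hφ _ (comp_schurMul_mem_predual α π x.2 f)
  rw [ContinuousLinearMap.comp_apply, schurMul_one] at hlim
  refine hfx.not_ge (ge_of_tendsto ((RCLike.continuous_re.tendsto _).comp hlim)
    (Eventually.of_forall fun i => (hf _ (subset_closure ?_)).le))
  change schurMul x.1 (HerzSchur.ofFinsupp Γ (φ i)) ∈ algCrossedProduct (restrictAction α B hB)
    (π.comp (NonUnitalStarSubalgebraClass.subtype B))
  rw [schurMul_ofFinsupp α π hπ]
  exact sum_mem fun g _ => SMulMemClass.smul_mem _ (hgen g)
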